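/- Let $s=(s_n)_{n\ge 0}$ be an indeterminate Hamburger moment sequence normalized by $s_0=1$; that is, there is more than one positive measure on $\mathbb R$ with moments of every order and $\int x^n\,d\mu(x)=s_n$ for all $n\ge 0$. Let $\mu$ be any such measure (it has infinite support), let $p_n$ be the orthonormal polynomials of $\mu$ ($\deg p_n=n$, positive leading coefficient), and let $$q_n(z)=\int\frac{p_n(z)-p_n(x)}{z-x}\,d\mu(x)$$ be the polynomials of the second kind, where the quotient is understood as $p_n'(z)$ when $x=z$. Let $a_n=\int x\,p_n(x)p_{n+1}(x)\,d\mu(x)$ and $b_n=\int x\,p_n(x)^2\,d\mu(x)$ be the coefficients of the three-term recurrence relation $xp_n=a_np_{n+1}+b_np_n+a_{n-1}p_{n-1}$ (with $a_{-1}:=0$). Let $(T,D(T))$ be the Jacobi operator, i.e. the closure in $\ell^2=\ell^2(\mathbb N_0,\mathbb C)$ of the operator defined on sequences with only finitely many non-zero terms by $$(Jc)_n=a_{n-1}c_{n-1}+b_nc_n+a_nc_{n+1},\qquad n\ge 0.$$ Then for every $z\in\mathbb C$ the sequences $\mathfrak p_z=(p_n(z))_{n\ge0}$ and $\mathfrak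 q_z=(q_n(z))_{n\ge0}$ belong to $\ell^2$, so that the following functions of $u,v\in\mathbb C$ are well defined: $$A(u,v)=(u-v)\sum_{k=0}^\infty q_k(u)q_k(v),\qquad B(u,v)=-1+(u-v)\sum_{k=0}^\infty p_k(u)q_k(v),$$ $$C(u,v)=1+(u-v)\sum_{k=0}^\infty q_k(u)p_k(v),\qquad D(u,v)=(u-v)\sum_{k=0}^\infty p_k(u)p_k(v).$$ For all $z\in\mathbb C$ we have $\mathfrak p_z,\mathfrak q_z\notin D(T)$. Moreover, for all $u,v\in\mathbb C$: (i) There exists $\alpha\in\mathbb C$ such that $\mathfrak p_u+\alpha\mathfrak p_v\in D(T)$ if and only if $D(u,v)=0$. In the affirmative case $\alpha$ is uniquely determined as $\alpha=B(u,v)$. (ii) There exists $\beta\in\mathbb C$ such that $\mathfrak q_u+\beta\mathfrak q_v\in D(T)$ if and only if $A(u,v)=0$. In the affirmative case $\beta$ is uniquely determined as $\beta=-C(u,v)$. (iii) There exists $\gamma\in\mathbb C$ such that $\mathfrak p_u+\gamma\mathfrak q_v\in D(T)$ if and only if $B(u,v)=0$. In the affirmative case $\gamma$ is uniquely determined as $\gamma=-D(u,v)$.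 In particular $\mathfrak p_u+\gamma\mathfrak q_u\notin D(T)$ for all $u,\gamma\in\mathbb C$. -/

import Mathlib

open MeasureTheory Polynomial
open scoped ENNReal

namespace JacobiMoment

/-- `μ` is a solution of the Hamburger moment problem for `s`: it has moments of every order, and
`∫ x ^ n dμ = s n` for all `n`. -/
def IsSolution (s : ℕ → ℝ) (μ : Measure ℝ) : Prop :=
  ∀ n : ℕ, Integrable (fun x : ℝ => x ^ n) μ ∧ ∫ x, x ^ n ∂μ = s n

/-- The moment problem for `s` is indeterminate: it has more than one solution. -/
def IsIndeterminate (s : ℕ → ℝ) : Prop :=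
  ∃ μ ν : Measure ℝ, IsSolution s μ ∧ IsSolution s ν ∧ μ ≠ ν

/-! ### Orthonormal polynomials and polynomials of the second kind -/

/-- The inner product `∫ f g dμ` of two real polynomials. -/
noncomputable def polyInner (μ : Measure ℝ) (f g : ℝ[X]) : ℝ :=
  ∫ x, f.eval x * g.eval x ∂μ

/-- The monic orthogonal polynomials of `μ`, by the Gram-Schmidt procedure applied to the
monomials `1, X, X ^ 2, …`. -/
noncomputable def monicOrtho (μ : Measure ℝ) (n : ℕ) : ℝ[X] :=
  X ^ n - ∑ k : Fin n,
    C (polyInner μ (X ^ n) (monicOrtho μ k) /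
      polyInner μ (monicOrtho μ k) (monicOrtho μ k)) * monicOrtho μ k
termination_by n
decreasing_by all_goals exact k.2

/-- The orthonormal polynomials `p_n` of `μ`, with positive leading coefficient. -/
noncomputable def orthoPoly (μ : Measure ℝ) (n : ℕ) : ℝ[X] :=
  C (Real.sqrt (polyInner μ (monicOrtho μ n) (monicOrtho μ n)))⁻¹ * monicOrtho μ n

/-- The off-diagonal Jacobi coefficient `a_n = ∫ x p_n(x) p_{n+1}(x) dμ(x)`. -/
noncomputable def jacobiA (μ : Measure ℝ) (n : ℕ) : ℝ :=
  ∫ x, x * (orthoPoly μ n).eval x * (orthoPoly μ (n + 1)).eval x ∂μ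

/-- The diagonal Jacobi coefficient `b_n = ∫ x p_n(x) ^ 2 dμ(x)`. -/
noncomputable def jacobiB (μ : Measure ℝ) (n : ℕ) : ℝ :=
  ∫ x, x * (orthoPoly μ n).eval x ^ 2 ∂μ

/-- The sequence `(p_n(z))`. -/
noncomputable def pSeq (μ : Measure ℝ) (z : ℂ) (n : ℕ) : ℂ :=
  aeval z (orthoPoly μ n)

/-- The sequence `(q_n(z))`, `q_n(z) = ∫ (p_n(z) - p_n(x)) / (z - x) dμ(x)`. The quotient is
continued by `p_n'(z)` to `x = z`, that is, it is a polynomial in `x`. -/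
noncomputable def qSeq (μ : Measure ℝ) (z : ℂ) (n : ℕ) : ℂ :=
  ∫ x : ℝ, dslope (fun w : ℂ => aeval w (orthoPoly μ n)) z (x : ℂ) ∂μ

/-! ### Nevanlinna functions of two variables -/

/-- `A(u,v) = (u - v) ∑ q_k(u) q_k(v)`. -/
noncomputable def nevA (μ : Measure ℝ) (u v : ℂ) : ℂ :=
  (u - v) * ∑' k, qSeq μ u k * qSeq μ v k

/-- `B(u,v) = -1 + (u - v) ∑ p_k(u) q_k(v)`. -/
noncomputable def nevB (μ : Measure ℝ) (u v : ℂ) : ℂ :=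
  -1 + (u - v) * ∑' k, pSeq μ u k * qSeq μ v k

/-- `C(u,v) = 1 + (u - v) ∑ q_k(u) p_k(v)`. -/
noncomputable def nevC (μ : Measure ℝ) (u v : ℂ) : ℂ :=
  1 + (u - v) * ∑' k, qSeq μ u k * pSeq μ v k

/-- `D(u,v) = (u - v) ∑ p_k(u) p_k(v)`. -/
noncomputable def nevD (μ : Measure ℝ) (u v : ℂ) : ℂ :=
  (u - v) * ∑' k, pSeq μ u k * pSeq μ v k

/-! ### The Jacobi operator -/

/-- The Hilbert space of square summable complex sequences. -/
abbrev Ell2 : Type := lp (fun _ : ℕ => ℂ) 2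

/-- The subspace of sequences with only finitely many non-zero terms. -/
def finSeq : Submodule ℂ Ell2 where
  carrier := {c | (Function.support (c : ℕ → ℂ)).Finite}
  zero_mem' := by
    show (Function.support (0 : ℕ → ℂ)).Finite
    rw [Function.support_zero]
    exact Set.finite_empty
  add_mem' := by
    intro c d hc hd
    exact (hc.union hd).subset (Function.support_add (c : ℕ → ℂ) (d : ℕ → ℂ))
  smul_mem' := by
    intro r c hc
    exact hc.subset (Function.support_const_smul_subset r (c : ℕ → ℂ))

/-- The product of the Jacobi matrix with diagonal `b` and off-diagonals `a` and the column `c`: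
`(J c)_n = a_{n-1} c_{n-1} + b_n c_n + a_n c_{n+1}`, where `a_{-1} c_{-1} = 0`. -/
def jacobiMul (a b : ℕ → ℝ) (c : ℕ → ℂ) : ℕ → ℂ
  | 0 => b 0 * c 0 + a 0 * c 1
  | n + 1 => a n * c n + b (n + 1) * c (n + 1) + a (n + 1) * c (n + 2)

theorem jacobiMul_add (a b : ℕ → ℝ) (c d : ℕ → ℂ) :
    jacobiMul a b (c + d) = jacobiMul a b c + jacobiMul a b d := by
  ext n
  cases n <;> simp only [jacobiMul, Pi.add_apply] <;> ring

theorem jacobiMul_smul (a b : ℕ → ℝ) (r : ℂ) (c : ℕ → ℂ) :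
    jacobiMul a b (r • c) = r • jacobiMul a b c := by
  ext n
  cases n <;> simp only [jacobiMul, Pi.smul_apply, smul_eq_mul] <;> ring

theorem memlp_jacobiMul (a b : ℕ → ℝ) {c : ℕ → ℂ} (hc : (Function.support c).Finite) :
    Memℓp (jacobiMul a b c) 2 := by
  refine (memℓp_zero ?_).of_exponent_ge zero_le
  obtain ⟨N, hN⟩ := hc.bddAbove
  refine (Set.finite_Iic (N + 1)).subset fun n hn => ?_
  by_contra h
  have h0 : ∀ m, N < m → c m = 0 := fun m hm => by
    by_contra h'
    exact absurd (hN h') (by omega)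
  simp only [Set.mem_Iic, not_le] at h
  apply hn
  obtain ⟨m, rfl⟩ : ∃ m, n = m + 1 := ⟨n - 1, by omega⟩
  simp [jacobiMul, h0 m (by omega), h0 (m + 1) (by omega), h0 (m + 2) (by omega)]

/-- The Jacobi matrix as an operator in `ℓ²` with domain the finite sequences. -/
noncomputable def jacobiMatrixOp (a b : ℕ → ℝ) : Ell2 →ₗ.[ℂ] Ell2 where
  domain := finSeq
  toFun :=
    { toFun := fun c => ⟨jacobiMul a b c.1, memlp_jacobiMul a b c.2⟩
      map_add' := fun c d => Subtype.ext (jacobiMul_add a b c.1 d.1)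
      map_smul' := fun r c => Subtype.ext (jacobiMul_smul a b r c.1) }

/-- The Jacobi operator `(T, D(T))` of `μ`: the closure of the Jacobi matrix on the finite
sequences. -/
noncomputable def jacobiOp (μ : Measure ℝ) : Ell2 →ₗ.[ℂ] Ell2 :=
  (jacobiMatrixOp (jacobiA μ) (jacobiB μ)).closure

theorem dense_finSeq : Dense (finSeq : Set Ell2) := by
  intro c
  refine mem_closure_of_tendsto (lp.hasSum_single (by simp) c) (Filter.Eventually.of_forall ?_)
  intro s
  refine Submodule.sum_mem _ fun i _ => ?_
  refine (Set.finite_singleton i).subset fun j hj => ?_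
  by_contra h
  exact hj (by simp [Pi.single_eq_of_ne (show j ≠ i from h)])

theorem sum_jacobiMul (a b : ℕ → ℝ) (x y : ℕ → ℂ) (n : ℕ) :
    ∑ i ∈ Finset.range (n + 1), (x i * (starRingEnd ℂ) (jacobiMul a b y i) -
      jacobiMul a b x i * (starRingEnd ℂ) (y i)) =
      a n * (x n * (starRingEnd ℂ) (y (n + 1)) - x (n + 1) * (starRingEnd ℂ) (y n)) := by
  induction n with
  | zero => simp [jacobiMul]; ring
  | succ n ih => rw [Finset.sum_range_succ, ih]; simp [jacobiMul]; ring

theorem inner_jacobiMul (a b : ℕ → ℝ) (c d Jc Jd : Ell2)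
    (hc : (Function.support (c : ℕ → ℂ)).Finite) (hJc : (Jc : ℕ → ℂ) = jacobiMul a b c)
    (hJd : (Jd : ℕ → ℂ) = jacobiMul a b d) : inner ℂ Jd c = inner ℂ d Jc := by
  have key := (lp.hasSum_inner (𝕜 := ℂ) (G := fun _ : ℕ => ℂ) Jd c).sub
    (lp.hasSum_inner (𝕜 := ℂ) (G := fun _ : ℕ => ℂ) d Jc)
  have h1 := (Filter.tendsto_add_atTop_iff_nat 1).2 key.tendsto_sum_nat
  obtain ⟨N, hN⟩ := hc.bddAbove
  have h0 : ∀ m, N < m → c m = 0 := fun m hm => by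
    by_contra h'
    exact absurd (hN h') (by omega)
  refine sub_eq_zero.1 (tendsto_nhds_unique h1 (tendsto_const_nhds.congr' ?_))
  filter_upwards [Filter.eventually_gt_atTop N] with n hn
  have h2 := sum_jacobiMul a b c d n
  rw [h0 n hn, h0 (n + 1) (by omega)] at h2
  simp only [zero_mul, sub_zero, mul_zero] at h2
  simp only [RCLike.inner_apply, hJc, hJd]
  exact h2.symm

theorem jacobiMatrixOp_formal (a b : ℕ → ℝ) :
    (jacobiMatrixOp a b).IsFormalAdjoint (jacobiMatrixOp a b) := fun c d =>
  inner_jacobiMul a b d.1 c.1 _ _ d.2 rfl rfl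

/-- The operator on finite sequences is closable, so `jacobiOp` is its closure. -/
theorem jacobiMatrixOp_isClosable (a b : ℕ → ℝ) : (jacobiMatrixOp a b).IsClosable :=
  ((jacobiMatrixOp a b).adjoint_isClosed dense_finSeq).isClosable.leIsClosable
    ((jacobiMatrixOp_formal a b).le_adjoint dense_finSeq)

/-- `D(T)` consists of those `c` for which there are finite sequences `c^(k) → c` such that
`J c^(k)` converges. -/
theorem mem_jacobiOp_domain_iff (μ : Measure ℝ) (c : Ell2) :
    c ∈ (jacobiOp μ).domain ↔
      ∃ (x : ℕ → (jacobiMatrixOp (jacobiA μ) (jacobiB μ)).domain) (y : Ell2),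
      Filter.Tendsto (fun k => (x k : Ell2)) Filter.atTop (nhds c) ∧
      Filter.Tendsto (fun k => jacobiMatrixOp (jacobiA μ) (jacobiB μ) (x k)) Filter.atTop
        (nhds y) := by
  have hg := (jacobiMatrixOp_isClosable (jacobiA μ) (jacobiB μ)).graph_closure_eq_closure_graph
  rw [LinearPMap.mem_domain_iff]
  constructor
  · rintro ⟨y, hy⟩
    rw [jacobiOp, ← hg, ← SetLike.mem_coe, Submodule.topologicalClosure_coe,
      mem_closure_iff_seq_limit] at hy
    obtain ⟨w, hw, hlim⟩ := hy
    have hw' := fun k => (LinearPMap.mem_graph_iff _).1 (hw k)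
    choose x hx1 hx2 using hw'
    refine ⟨x, y, ?_, ?_⟩
    · simpa only [hx1, Function.comp_def] using (continuous_fst.tendsto _).comp hlim
    · simpa only [hx2, Function.comp_def] using (continuous_snd.tendsto _).comp hlim
  · rintro ⟨x, y, hx, hy⟩
    refine ⟨y, ?_⟩
    rw [jacobiOp, ← hg, ← SetLike.mem_coe, Submodule.topologicalClosure_coe]
    exact mem_closure_of_tendsto (hx.prodMk_nhds hy)
      (Filter.Eventually.of_forall fun k => (jacobiMatrixOp _ _).mem_graph (x k))

end JacobiMoment

namespace JacobiMoment

/-! ### The moment functional -/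

/-! On the maximal domain (`x` and `Jx` both in `ℓ²`) consider the bilinear boundary form `W(x, y) =
∑ (x_k (Jy)_k - (Jx)_k y_k)`. By Green's formula it is the limit of the discrete Wronskians `a_n
(x_n y_{n+1} - x_{n+1} y_n)`. By duality, `D(T)` consists of the `c` in the maximal domain with
`W(c, y) = 0` for all `y` there. The Plücker identity for Wronskians survives in the limit, so once
`W(p, q) = 1` only the two conditions `W(c, p) = W(c, q) = 0` remain
(`mem_jacobiOp_domain_iff_boundary`).

Since `J p_z = z p_z` and `J q_z = z q_z + e_0`, the values of `W` on these sequences are `-A`,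
`-B`, `-C`, `-D`. Testing `p_u + α p_v` and its analogues against `p_v`, `q_v` gives two scalar
equations. As `A(v,v) = D(v,v) = 0`, `B(v,v) = -1` and `C(v,v) = 1`, one equation does not contain
the unknown coefficient and is the stated criterion; the other determines the coefficient.

Square summability comes from indeterminacy. Two distinct solutions have different Cauchy transforms
at some non-real `z`, because resolvent functions determine a finite measure
(`ext_of_cauchyTransform`). Bessel's inequality for `(x - z)⁻¹` puts `q_z + m p_z` in `ℓ²` for two
distinct values of `m`, hence also `p_z` and `q_z`. Variation of constants carries this to every
point (`memℓp_of_jacobiMul_eq`). -/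

theorem integrable_eval {μ : Measure ℝ} (h : ∀ n : ℕ, Integrable (fun x : ℝ => x ^ n) μ)
    (f : ℝ[X]) : Integrable (fun x => f.eval x) μ := by
  simp only [eval_eq_sum, Polynomial.sum]
  exact integrable_finsetSum _ fun i _ => (h i).const_mul _

/-- The linear functional `f ↦ ∫ f dμ` on real polynomials. -/
noncomputable def momentFunctional (μ : Measure ℝ)
    (h : ∀ n : ℕ, Integrable (fun x : ℝ => x ^ n) μ) : ℝ[X] →ₗ[ℝ] ℝ where
  toFun f := ∫ x, f.eval x ∂μ
  map_add' f g := by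
    simp only [eval_add]
    exact integral_add (integrable_eval h f) (integrable_eval h g)
  map_smul' r f := by
    simp only [eval_smul, smul_eq_mul, RingHom.id_apply]
    exact integral_const_mul _ _

theorem polyInner_eq {μ : Measure ℝ} (h : ∀ n : ℕ, Integrable (fun x : ℝ => x ^ n) μ)
    (f g : ℝ[X]) : polyInner μ f g = momentFunctional μ h (f * g) := by
  simp [polyInner, momentFunctional]

theorem momentFunctional_C_mul {μ : Measure ℝ} (h : ∀ n : ℕ, Integrable (fun x : ℝ => x ^ n) μ)
    (r : ℝ) (f : ℝ[X]) : momentFunctional μ h (C r * f) = r * momentFunctional μ h f := by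
  rw [← smul_eq_C_mul, map_smul, smul_eq_mul]

/-- If `∫ f² dμ = 0`, then `μ` is carried by the finite root set of `f`, against the infinite
support. This makes Gram-Schmidt nondegenerate. -/
theorem momentFunctional_sq_pos {μ : Measure ℝ}
    (h : ∀ n : ℕ, Integrable (fun x : ℝ => x ^ n) μ) (hsupp : μ.support.Infinite) {f : ℝ[X]}
    (hf : f ≠ 0) : 0 < momentFunctional μ h (f * f) := by
  have hnn : ∀ x, 0 ≤ (f * f).eval x := fun x => by rw [eval_mul]; exact mul_self_nonneg _
  refine (integral_nonneg hnn).lt_of_ne' fun h0 => hsupp ?_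
  have h1 := (integral_eq_zero_iff_of_nonneg hnn (integrable_eval h (f * f))).1 h0
  refine f.rootSet_finite ℝ |>.subset (Measure.support_subset_of_isClosed
    (f.rootSet_finite ℝ).isClosed ?_)
  filter_upwards [h1] with x hx
  rw [mem_rootSet]
  refine ⟨hf, ?_⟩
  simpa using hx

/-! ### Orthonormality -/

theorem monicOrtho_degree (μ : Measure ℝ) (n : ℕ) :
    (monicOrtho μ n).Monic ∧ (monicOrtho μ n).degree = n := by
  induction n using Nat.strong_induction_on with
  | _ n ih =>
    have hlt : (∑ k : Fin n, C (polyInner μ (X ^ n) (monicOrtho μ k) /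
        polyInner μ (monicOrtho μ k) (monicOrtho μ k)) * monicOrtho μ k).degree < n := by
      rcases Nat.eq_zero_or_pos n with rfl | hn
      · simp
      refine (degree_sum_le _ _).trans_lt ((Finset.sup_lt_iff (by simp)).2 fun k _ => ?_)
      rw [← smul_eq_C_mul]
      refine (degree_smul_le _ _).trans_lt ?_
      rw [(ih k k.2).2]
      exact_mod_cast k.2
    rw [monicOrtho]
    refine ⟨(monic_X_pow n).sub_of_left (by rwa [degree_X_pow]), ?_⟩
    rw [degree_sub_eq_left_of_degree_lt (by rwa [degree_X_pow]), degree_X_pow]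

theorem monicOrtho_orthogonal {μ : Measure ℝ}
    (h : ∀ n : ℕ, Integrable (fun x : ℝ => x ^ n) μ) (hsupp : μ.support.Infinite) (n : ℕ) :
    ∀ j < n, momentFunctional μ h (monicOrtho μ n * monicOrtho μ j) = 0 := by
  induction n using Nat.strong_induction_on with
  | _ n ih =>
    intro j hj
    have hpos := momentFunctional_sq_pos h hsupp (monicOrtho_degree μ j).1.ne_zero
    rw [monicOrtho, sub_mul, map_sub, Finset.sum_mul, map_sum,
      Finset.sum_eq_single (⟨j, hj⟩ : Fin n)]
    · rw [mul_assoc, momentFunctional_C_mul, polyInner_eq h, polyInner_eq h,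
        div_mul_cancel₀ _ hpos.ne', sub_self]
    · intro k _ hk
      rw [mul_assoc, momentFunctional_C_mul]
      have hkj : (k : ℕ) ≠ j := fun e => hk (Fin.ext e)
      rcases hkj.lt_or_gt with hlt | hlt
      · rw [mul_comm (monicOrtho μ k), ih j hj k hlt, mul_zero]
      · rw [ih k k.2 j hlt, mul_zero]
    · simp

theorem orthoPoly_degree {μ : Measure ℝ} (h : ∀ n : ℕ, Integrable (fun x : ℝ => x ^ n) μ)
    (hsupp : μ.support.Infinite) (n : ℕ) : (orthoPoly μ n).degree = n := by
  have hpos := momentFunctional_sq_pos h hsupp (monicOrtho_degree μ n).1.ne_zero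
  rw [orthoPoly, degree_C_mul, (monicOrtho_degree μ n).2]
  rw [polyInner_eq h]
  exact inv_ne_zero (Real.sqrt_pos.2 hpos).ne'

theorem orthoPoly_orthonormal {μ : Measure ℝ}
    (h : ∀ n : ℕ, Integrable (fun x : ℝ => x ^ n) μ) (hsupp : μ.support.Infinite) (m n : ℕ) :
    momentFunctional μ h (orthoPoly μ m * orthoPoly μ n) = if m = n then 1 else 0 := by
  have e : orthoPoly μ m * orthoPoly μ n =
      C (Real.sqrt (polyInner μ (monicOrtho μ m) (monicOrtho μ m)))⁻¹ *
      (C (Real.sqrt (polyInner μ (monicOrtho μ n) (monicOrtho μ n)))⁻¹ *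
        (monicOrtho μ m * monicOrtho μ n)) := by
    rw [orthoPoly, orthoPoly]; ring
  rw [e, momentFunctional_C_mul, momentFunctional_C_mul]
  split_ifs with hmn
  · subst hmn
    have hpos := momentFunctional_sq_pos h hsupp (monicOrtho_degree μ m).1.ne_zero
    rw [polyInner_eq h]
    have hs := (Real.sqrt_pos.2 hpos).ne'
    nth_rw 3 [← Real.mul_self_sqrt hpos.le]
    field_simp
  · rcases Ne.lt_or_gt hmn with hlt | hlt
    · rw [mul_comm (monicOrtho μ m), monicOrtho_orthogonal h hsupp n m hlt]; simp
    · rw [monicOrtho_orthogonal h hsupp m n hlt]; simp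

theorem exists_orthoPoly_expansion {μ : Measure ℝ}
    (h : ∀ n : ℕ, Integrable (fun x : ℝ => x ^ n) μ) (hsupp : μ.support.Infinite) (N : ℕ) :
    ∀ f : ℝ[X], f.degree < N → ∃ c : ℕ → ℝ, f = ∑ k ∈ Finset.range N, C (c k) * orthoPoly μ k := by
  induction N with
  | zero =>
    intro f hf
    refine ⟨0, ?_⟩
    simpa using hf
  | succ N ih =>
    intro f hf
    have hd := orthoPoly_degree h hsupp N
    have hne : (orthoPoly μ N).coeff N ≠ 0 := coeff_ne_zero_of_eq_degree hd
    set r := f.coeff N / (orthoPoly μ N).coeff N with hr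
    obtain ⟨c, hc⟩ := ih (f - C r * orthoPoly μ N) (by
      rw [degree_lt_iff_coeff_zero] at hf ⊢
      intro m hm
      rcases hm.eq_or_lt with rfl | hm
      · rw [coeff_sub, coeff_C_mul, hr, div_mul_cancel₀ _ hne, sub_self]
      · rw [coeff_sub, coeff_C_mul, hf m hm, coeff_eq_zero_of_degree_lt (n := m)
          (p := orthoPoly μ N) (by rw [hd]; exact_mod_cast hm)]
        simp)
    refine ⟨Function.update c N r, ?_⟩
    rw [Finset.sum_range_succ, Function.update_self, Finset.sum_congr rfl (g := fun k =>
      C (c k) * orthoPoly μ k), ← hc, sub_add_cancel]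
    intro k hk
    rw [Function.update_of_ne (Finset.mem_range.1 hk).ne]

theorem orthoPoly_expansion {μ : Measure ℝ}
    (h : ∀ n : ℕ, Integrable (fun x : ℝ => x ^ n) μ) (hsupp : μ.support.Infinite) {N : ℕ}
    {f : ℝ[X]} (hf : f.degree < N) :
    f = ∑ k ∈ Finset.range N, C (momentFunctional μ h (f * orthoPoly μ k)) * orthoPoly μ k := by
  obtain ⟨c, hc⟩ := exists_orthoPoly_expansion h hsupp N f hf
  nth_rw 1 [hc]
  refine Finset.sum_congr rfl fun k hk => ?_
  congr 2
  rw [hc, Finset.sum_mul, map_sum, Finset.sum_eq_single_of_mem k hk]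
  · rw [mul_assoc, momentFunctional_C_mul, orthoPoly_orthonormal h hsupp, if_pos rfl, mul_one]
  · intro j _ hj
    rw [mul_assoc, momentFunctional_C_mul, orthoPoly_orthonormal h hsupp, if_neg hj, mul_zero]

theorem momentFunctional_mul_orthoPoly {μ : Measure ℝ}
    (h : ∀ n : ℕ, Integrable (fun x : ℝ => x ^ n) μ) (hsupp : μ.support.Infinite) {N : ℕ}
    {f : ℝ[X]} (hf : f.degree < N) : momentFunctional μ h (f * orthoPoly μ N) = 0 := by
  obtain ⟨c, rfl⟩ := exists_orthoPoly_expansion h hsupp N f hf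
  rw [Finset.sum_mul, map_sum]
  refine Finset.sum_eq_zero fun j hj => ?_
  rw [mul_assoc, momentFunctional_C_mul, orthoPoly_orthonormal h hsupp,
    if_neg (Finset.mem_range.1 hj).ne, mul_zero]

theorem jacobiA_eq {μ : Measure ℝ} (h : ∀ n : ℕ, Integrable (fun x : ℝ => x ^ n) μ) (n : ℕ) :
    jacobiA μ n = momentFunctional μ h (X * orthoPoly μ n * orthoPoly μ (n + 1)) := by
  simp [jacobiA, momentFunctional]

theorem jacobiB_eq {μ : Measure ℝ} (h : ∀ n : ℕ, Integrable (fun x : ℝ => x ^ n) μ) (n : ℕ) :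
    jacobiB μ n = momentFunctional μ h (X * orthoPoly μ n * orthoPoly μ n) := by
  simp [jacobiB, momentFunctional, pow_two, mul_assoc]

theorem X_mul_orthoPoly_degree {μ : Measure ℝ}
    (h : ∀ n : ℕ, Integrable (fun x : ℝ => x ^ n) μ) (hsupp : μ.support.Infinite) (n : ℕ) :
    (X * orthoPoly μ n).degree < ((n + 2 : ℕ) : WithBot ℕ) := by
  rw [degree_mul, orthoPoly_degree h hsupp, degree_X]
  norm_cast
  omega

/-- The three-term recurrence, first step. -/
theorem X_mul_orthoPoly_zero {μ : Measure ℝ}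
    (h : ∀ n : ℕ, Integrable (fun x : ℝ => x ^ n) μ) (hsupp : μ.support.Infinite) :
    X * orthoPoly μ 0 = C (jacobiB μ 0) * orthoPoly μ 0 + C (jacobiA μ 0) * orthoPoly μ 1 := by
  nth_rw 1 [orthoPoly_expansion h hsupp (X_mul_orthoPoly_degree h hsupp 0)]
  simp [Finset.sum_range_succ, jacobiA_eq h, jacobiB_eq h]

/-- The three-term recurrence. -/
theorem X_mul_orthoPoly_succ {μ : Measure ℝ}
    (h : ∀ n : ℕ, Integrable (fun x : ℝ => x ^ n) μ) (hsupp : μ.support.Infinite) (n : ℕ) :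
    X * orthoPoly μ (n + 1) = C (jacobiA μ n) * orthoPoly μ n +
      C (jacobiB μ (n + 1)) * orthoPoly μ (n + 1) +
      C (jacobiA μ (n + 1)) * orthoPoly μ (n + 2) := by
  have hcomm : ∀ k, X * orthoPoly μ (n + 1) * orthoPoly μ k =
      X * orthoPoly μ k * orthoPoly μ (n + 1) := fun k => by ring
  nth_rw 1 [orthoPoly_expansion h hsupp (X_mul_orthoPoly_degree h hsupp (n + 1))]
  rw [Finset.sum_range_succ, Finset.sum_range_succ, Finset.sum_range_succ, Finset.sum_eq_zero,
    zero_add, jacobiA_eq h, jacobiA_eq h, jacobiB_eq h, hcomm n]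
  -- For `k < n` the factor `X` moves over to `p_k`, and `X p_k` has degree at most `n`, so it is
  -- orthogonal to `p_{n+1}`.
  intro k hk
  rw [hcomm k, momentFunctional_mul_orthoPoly h hsupp, C_0, zero_mul]
  refine (X_mul_orthoPoly_degree h hsupp k).trans_le ?_
  have := Finset.mem_range.1 hk
  exact_mod_cast (by omega : k + 2 ≤ n + 1)

theorem orthoPoly_zero {μ : Measure ℝ} (h0 : ∫ _, (1 : ℝ) ∂μ = 1) : orthoPoly μ 0 = 1 := by
  have hm : monicOrtho μ 0 = 1 := by rw [monicOrtho]; simp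
  rw [orthoPoly, hm]
  simp only [polyInner, eval_one, mul_one, h0]
  simp

/-! ### The sequences `p_n(z)` and `q_n(z)` -/

theorem integrable_eval_complex {μ : Measure ℝ}
    (h : ∀ n : ℕ, Integrable (fun x : ℝ => x ^ n) μ) (P : ℂ[X]) :
    Integrable (fun x : ℝ => P.eval (x : ℂ)) μ := by
  simp only [eval_eq_sum, Polynomial.sum]
  refine integrable_finsetSum _ fun i _ => Integrable.const_mul ?_ _
  simpa using (h i).ofReal (𝕜 := ℂ)

theorem integral_eval_map {μ : Measure ℝ} (h : ∀ n : ℕ, Integrable (fun x : ℝ => x ^ n) μ)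
    (f : ℝ[X]) : ∫ x : ℝ, (f.map (algebraMap ℝ ℂ)).eval (x : ℂ) ∂μ =
      (momentFunctional μ h f : ℝ) := by
  rw [momentFunctional, LinearMap.coe_mk, AddHom.coe_mk, ← integral_complex_ofReal]
  refine integral_congr_ae (Filter.Eventually.of_forall fun x => ?_)
  exact eval_map_algebraMap f (x : ℂ) |>.trans (aeval_algebraMap_apply_eq_algebraMap_eval x f)

theorem divByMonic_spec (P : ℂ[X]) (z : ℂ) :
    (X - C z) * (P /ₘ (X - C z)) = P - C (P.eval z) := by
  rw [eq_sub_iff_add_eq', ← modByMonic_X_sub_C_eq_C_eval, modByMonic_add_div]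

/-- The difference quotient is a polynomial in `w`. Hence `q_n(z)` is determined by the moments
alone, and division by `X - z` transfers the recurrence of `p_n` to `q_n`. -/
theorem dslope_eval (P : ℂ[X]) (z w : ℂ) :
    dslope (fun w => P.eval w) z w = (P /ₘ (X - C z)).eval w := by
  set Q := P /ₘ (X - C z) with hQ
  have hP : P = (X - C z) * Q + C (P.eval z) := by rw [hQ, divByMonic_spec]; ring
  rcases eq_or_ne w z with rfl | hne
  · rw [dslope_same, Polynomial.deriv]
    nth_rw 1 [hP]
    simp
  · rw [dslope_of_ne _ hne, slope_def_field, div_eq_iff (sub_ne_zero.2 hne)]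
    have := congrArg (eval w) (divByMonic_spec P z)
    simp only [eval_mul, eval_sub, eval_X, eval_C] at this
    rw [← this]; ring

theorem qSeq_eq (μ : Measure ℝ) (z : ℂ) (n : ℕ) : qSeq μ z n =
    ∫ x : ℝ, (((orthoPoly μ n).map (algebraMap ℝ ℂ)) /ₘ (X - C z)).eval (x : ℂ) ∂μ := by
  simp only [qSeq, ← dslope_eval, eval_map_algebraMap]

theorem X_mul_divByMonic (P : ℂ[X]) (z : ℂ) :
    (X * P) /ₘ (X - C z) = C z * (P /ₘ (X - C z)) + P := by
  apply mul_left_cancel₀ (X_sub_C_ne_zero z)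
  rw [divByMonic_spec, mul_add, mul_left_comm, divByMonic_spec]
  simp only [eval_mul, eval_X, C_mul]
  ring

theorem linear_divByMonic (P Q R : ℂ[X]) (a b c z : ℂ) :
    (C a * P + C b * Q + C c * R) /ₘ (X - C z) =
      C a * (P /ₘ (X - C z)) + C b * (Q /ₘ (X - C z)) + C c * (R /ₘ (X - C z)) := by
  apply mul_left_cancel₀ (X_sub_C_ne_zero z)
  rw [divByMonic_spec]
  simp only [mul_add, mul_left_comm (X - C z), divByMonic_spec]
  simp only [eval_mul, eval_add, eval_C, C_mul, C_add]
  ring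

theorem pSeq_zero {μ : Measure ℝ} (h0 : ∫ _, (1 : ℝ) ∂μ = 1) (z : ℂ) : pSeq μ z 0 = 1 := by
  simp [pSeq, orthoPoly_zero h0]

theorem qSeq_zero {μ : Measure ℝ} (h0 : ∫ _, (1 : ℝ) ∂μ = 1) (z : ℂ) : qSeq μ z 0 = 0 := by
  have h1 : (1 : ℂ[X]) /ₘ (X - C z) = 0 := by
    rw [divByMonic_eq_zero_iff (monic_X_sub_C z), degree_X_sub_C, degree_one]
    exact zero_lt_one
  simp [qSeq_eq, orthoPoly_zero h0, h1]

theorem jacobiMul_pSeq {μ : Measure ℝ} (h : ∀ n : ℕ, Integrable (fun x : ℝ => x ^ n) μ)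
    (hsupp : μ.support.Infinite) (z : ℂ) (n : ℕ) :
    jacobiMul (jacobiA μ) (jacobiB μ) (pSeq μ z) n = z * pSeq μ z n := by
  cases n with
  | zero =>
    have := congrArg (aeval z) (X_mul_orthoPoly_zero h hsupp)
    simp only [map_mul, map_add, aeval_X, aeval_C, Complex.coe_algebraMap] at this
    exact this.symm
  | succ n =>
    have := congrArg (aeval z) (X_mul_orthoPoly_succ h hsupp n)
    simp only [map_mul, map_add, aeval_X, aeval_C, Complex.coe_algebraMap] at this
    exact this.symm

/-- Taking difference quotients in `x p_n = …` leaves the extra summand `p_n` of `X_mul_divByMonic`.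
Its integral is `δ_{n0}`, because `p_0 = 1`. -/
theorem jacobiMul_qSeq {μ : Measure ℝ} (h : ∀ n : ℕ, Integrable (fun x : ℝ => x ^ n) μ)
    (hsupp : μ.support.Infinite) (h0 : ∫ _, (1 : ℝ) ∂μ = 1) (z : ℂ) (n : ℕ) :
    jacobiMul (jacobiA μ) (jacobiB μ) (qSeq μ z) n =
      z * qSeq μ z n + if n = 0 then 1 else 0 := by
  have hi : ∀ (r : ℂ) (P : ℂ[X]), Integrable (fun x : ℝ => r * P.eval (x : ℂ)) μ :=
    fun r P => (integrable_eval_complex h P).const_mul r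
  have hp : ∫ x : ℝ, ((orthoPoly μ n).map (algebraMap ℝ ℂ)).eval (x : ℂ) ∂μ =
      if n = 0 then 1 else 0 := by
    rw [integral_eval_map h]
    have := orthoPoly_orthonormal h hsupp n 0
    rw [orthoPoly_zero h0, mul_one] at this
    rw [this]; split_ifs <;> simp
  have hX : ∫ x : ℝ, ((X * (orthoPoly μ n).map (algebraMap ℝ ℂ)) /ₘ (X - C z)).eval (x : ℂ) ∂μ =
      z * qSeq μ z n + if n = 0 then 1 else 0 := by
    simp only [X_mul_divByMonic, eval_add, eval_mul, eval_C]
    rw [integral_add (hi _ _) (integrable_eval_complex h _), integral_const_mul, hp, qSeq_eq]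
  have hlin : ∀ (P Q R : ℂ[X]) (a b c : ℂ),
      ∫ x : ℝ, ((C a * P + C b * Q + C c * R) /ₘ (X - C z)).eval (x : ℂ) ∂μ =
      a * ∫ x : ℝ, (P /ₘ (X - C z)).eval (x : ℂ) ∂μ +
      b * ∫ x : ℝ, (Q /ₘ (X - C z)).eval (x : ℂ) ∂μ +
      c * ∫ x : ℝ, (R /ₘ (X - C z)).eval (x : ℂ) ∂μ := by
    intro P Q R a b c
    simp only [linear_divByMonic, eval_add, eval_mul, eval_C]
    rw [integral_add (by exact (hi _ _).add (hi _ _)) (hi _ _), integral_add (hi _ _) (hi _ _),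
      integral_const_mul, integral_const_mul, integral_const_mul]
  rw [← hX]
  cases n with
  | zero =>
    have := congrArg (Polynomial.map (algebraMap ℝ ℂ)) (X_mul_orthoPoly_zero h hsupp)
    simp only [Polynomial.map_mul, Polynomial.map_add, map_X, map_C] at this
    have h3 := hlin ((orthoPoly μ 0).map (algebraMap ℝ ℂ)) ((orthoPoly μ 1).map (algebraMap ℝ ℂ))
      0 (jacobiB μ 0) (jacobiA μ 0) 0
    simp only [C_0, zero_mul, add_zero] at h3
    rw [this]
    simp only [Complex.coe_algebraMap]
    rw [h3, ← qSeq_eq, ← qSeq_eq]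
    rfl
  | succ n =>
    have := congrArg (Polynomial.map (algebraMap ℝ ℂ)) (X_mul_orthoPoly_succ h hsupp n)
    simp only [Polynomial.map_mul, Polynomial.map_add, map_X, map_C] at this
    rw [this]
    simp only [Complex.coe_algebraMap]
    rw [hlin, ← qSeq_eq, ← qSeq_eq, ← qSeq_eq]
    rfl

/-! ### The Cauchy transform determines a finite measure -/

theorem norm_inv_sub_le {z : ℂ} (hz : z.im ≠ 0) (x : ℝ) : ‖((x : ℂ) - z)⁻¹‖ ≤ |z.im|⁻¹ := by
  rw [norm_inv]
  refine inv_anti₀ (abs_pos.2 hz) ?_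
  simpa using Complex.abs_im_le_norm ((x : ℂ) - z)

theorem ofReal_sub_ne_zero {z : ℂ} (hz : z.im ≠ 0) (x : ℝ) : (x : ℂ) - z ≠ 0 := fun h => by
  have := congrArg Complex.im h
  simp at this
  exact hz this

/-- The bounded continuous function `x ↦ (x - z)⁻¹` for non-real `z`. -/
noncomputable def resolventFun (z : {z : ℂ // z.im ≠ 0}) : BoundedContinuousFunction ℝ ℂ :=
  BoundedContinuousFunction.ofNormedAddCommGroup (fun x : ℝ => ((x : ℂ) - z)⁻¹)
    ((Complex.continuous_ofReal.sub continuous_const).inv₀ (ofReal_sub_ne_zero z.2))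
    |(z : ℂ).im|⁻¹ (norm_inv_sub_le z.2)

theorem resolventFun_apply (z : {z : ℂ // z.im ≠ 0}) (x : ℝ) :
    resolventFun z x = ((x : ℂ) - z)⁻¹ := rfl

theorem resolventFun_norm_le (z : {z : ℂ // z.im ≠ 0}) : ‖resolventFun z‖ ≤ |(z : ℂ).im|⁻¹ :=
  BoundedContinuousFunction.norm_ofNormedAddCommGroup_le _ (by positivity) _

/-- The resolvent identity: products at distinct points are linear combinations, so a linear span
can be closed under multiplication. -/
theorem resolventFun_sub (z w : {z : ℂ // z.im ≠ 0}) :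
    resolventFun z - resolventFun w = ((z : ℂ) - w) • (resolventFun z * resolventFun w) := by
  ext x
  have h1 := ofReal_sub_ne_zero z.2 x
  have h2 := ofReal_sub_ne_zero w.2 x
  simp only [BoundedContinuousFunction.coe_sub, BoundedContinuousFunction.coe_smul,
    BoundedContinuousFunction.coe_mul, Pi.sub_apply, Pi.mul_apply, resolventFun_apply, smul_eq_mul]
  field_simp
  ring

/-- The closed span of `1` and the functions `x ↦ (x - z)⁻¹`. -/
noncomputable def resolventSpan : Submodule ℂ (BoundedContinuousFunction ℝ ℂ) :=
  (Submodule.span ℂ (insert 1 (Set.range resolventFun))).topologicalClosure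

theorem one_mem_resolventSpan : 1 ∈ resolventSpan :=
  Submodule.le_topologicalClosure _ (Submodule.subset_span (Set.mem_insert _ _))

theorem resolventFun_mem (z : {z : ℂ // z.im ≠ 0}) : resolventFun z ∈ resolventSpan :=
  Submodule.le_topologicalClosure _ (Submodule.subset_span (Set.mem_insert_of_mem _ ⟨z, rfl⟩))

theorem resolventFun_mul_mem_of_ne {z w : {z : ℂ // z.im ≠ 0}} (h : z ≠ w) :
    resolventFun z * resolventFun w ∈ resolventSpan := by
  have h' : (z : ℂ) - w ≠ 0 := sub_ne_zero.2 fun e => h (Subtype.ext e)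
  have : resolventFun z * resolventFun w =
      ((z : ℂ) - w)⁻¹ • (resolventFun z - resolventFun w) := by
    rw [resolventFun_sub, smul_smul, inv_mul_cancel₀ h', one_smul]
  rw [this]
  exact Submodule.smul_mem _ _ (Submodule.sub_mem _ (resolventFun_mem z) (resolventFun_mem w))

theorem resolventFun_mul_mem (z w : {z : ℂ // z.im ≠ 0}) :
    resolventFun z * resolventFun w ∈ resolventSpan := by
  rcases ne_or_eq z w with h | rfl
  · exact resolventFun_mul_mem_of_ne h
  have hcl : IsClosed (resolventSpan : Set (BoundedContinuousFunction ℝ ℂ)) :=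
    Submodule.isClosed_topologicalClosure _
  -- Squares are limits of products at distinct points. A horizontal shift keeps the imaginary part,
  -- so the norm bound is uniform in `n`.
  let w : ℕ → {z : ℂ // z.im ≠ 0} := fun n =>
    ⟨z + ((1 / ((n : ℝ) + 1) : ℝ) : ℂ), by rw [Complex.add_im, Complex.ofReal_im, add_zero]; exact z.2⟩
  have hw : ∀ n, (w n : ℂ) - z = ((1 / ((n : ℝ) + 1) : ℝ) : ℂ) := fun n => by simp [w]
  have hwim : ∀ n, (w n : ℂ).im = (z : ℂ).im := fun n => by
    simp only [w, Complex.add_im, Complex.ofReal_im, add_zero]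
  have hlim : Filter.Tendsto (fun n => resolventFun (w n)) Filter.atTop (nhds (resolventFun z)) := by
    rw [tendsto_iff_norm_sub_tendsto_zero]
    refine squeeze_zero (g := fun n : ℕ => 1 / ((n : ℝ) + 1) * (|(z : ℂ).im|⁻¹ * |(z : ℂ).im|⁻¹))
      (fun _ => norm_nonneg _) (fun n => ?_) ?_
    · rw [resolventFun_sub, hw, norm_smul, Complex.norm_real, Real.norm_of_nonneg (by positivity)]
      refine mul_le_mul_of_nonneg_left ((norm_mul_le _ _).trans ?_) (by positivity)
      refine mul_le_mul ?_ (resolventFun_norm_le z) (norm_nonneg _) (by positivity)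
      rw [← hwim n]
      exact resolventFun_norm_le _
    · simpa using tendsto_one_div_add_atTop_nhds_zero_nat.mul_const
        (|(z : ℂ).im|⁻¹ * |(z : ℂ).im|⁻¹)
  refine hcl.mem_of_tendsto (tendsto_const_nhds.mul hlim)
    (Filter.Eventually.of_forall fun n => resolventFun_mul_mem_of_ne fun e => ?_)
  have h1 := hw n
  rw [← e, sub_self] at h1
  have h2 : (1 / ((n : ℝ) + 1) : ℝ) ≠ 0 := by positivity
  exact h2 (by exact_mod_cast h1.symm)

/-- Multiplication is linear and continuous in each factor separately, so it suffices to check the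
generators. -/
theorem mul_mem_resolventSpan {f g : BoundedContinuousFunction ℝ ℂ} (hf : f ∈ resolventSpan)
    (hg : g ∈ resolventSpan) : f * g ∈ resolventSpan := by
  have hcl : IsClosed (resolventSpan : Set (BoundedContinuousFunction ℝ ℂ)) :=
    Submodule.isClosed_topologicalClosure _
  have key : ∀ a ∈ insert 1 (Set.range resolventFun), ∀ b ∈ insert 1 (Set.range resolventFun),
      a * b ∈ resolventSpan := by
    rintro a (rfl | ⟨z, rfl⟩) b (rfl | ⟨w, rfl⟩)
    · rw [mul_one]; exact one_mem_resolventSpan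
    · rw [one_mul]; exact resolventFun_mem w
    · rw [mul_one]; exact resolventFun_mem z
    · exact resolventFun_mul_mem z w
  have h1 : ∀ a ∈ insert 1 (Set.range resolventFun), ∀ g ∈ resolventSpan,
      a * g ∈ resolventSpan := by
    intro a ha g hg
    have : resolventSpan ≤ resolventSpan.comap (LinearMap.mulLeft ℂ a) := by
      refine Submodule.topologicalClosure_minimal _ (Submodule.span_le.2 fun b hb => key a ha b hb) ?_
      exact hcl.preimage (continuous_const.mul continuous_id)
    exact this hg
  have : resolventSpan ≤ resolventSpan.comap (LinearMap.mulRight ℂ g) := by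
    refine Submodule.topologicalClosure_minimal _ (Submodule.span_le.2 fun b hb => h1 b hb g hg) ?_
    exact hcl.preimage (continuous_id.mul continuous_const)
  exact this hf

theorem star_resolventFun (z : {z : ℂ // z.im ≠ 0}) :
    star (resolventFun z) = resolventFun ⟨(starRingEnd ℂ) z, by simpa using z.2⟩ := by
  ext x
  simp [resolventFun_apply]

theorem adjoin_resolventFun_le {f : BoundedContinuousFunction ℝ ℂ}
    (hf : f ∈ StarAlgebra.adjoin ℂ (Set.range resolventFun)) : f ∈ resolventSpan := by
  rw [← StarSubalgebra.mem_toSubalgebra, StarAlgebra.adjoin_toSubalgebra] at hf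
  induction hf using Algebra.adjoin_induction with
  | mem f hf =>
    rcases hf with ⟨z, rfl⟩ | hf
    · exact resolventFun_mem z
    · obtain ⟨z, hz⟩ := Set.mem_star.1 hf
      rw [← star_star f, ← hz, star_resolventFun]
      exact resolventFun_mem _
  | algebraMap r =>
    rw [Algebra.algebraMap_eq_smul_one]
    exact Submodule.smul_mem _ _ one_mem_resolventSpan
  | add f g _ _ hf hg => exact Submodule.add_mem _ hf hg
  | mul f g _ _ hf hg => exact mul_mem_resolventSpan hf hg

theorem integral_eq_of_mem_resolventSpan {P P' : Measure ℝ} [IsFiniteMeasure P]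
    [IsFiniteMeasure P'] (h1 : ∫ _, (1 : ℂ) ∂P = ∫ _, (1 : ℂ) ∂P')
    (h : ∀ z : ℂ, z.im ≠ 0 → ∫ x : ℝ, ((x : ℂ) - z)⁻¹ ∂P = ∫ x : ℝ, ((x : ℂ) - z)⁻¹ ∂P')
    {f : BoundedContinuousFunction ℝ ℂ} (hf : f ∈ resolventSpan) :
    ∫ x, f x ∂P = ∫ x, f x ∂P' := by
  let I : ∀ (Q : Measure ℝ) [IsFiniteMeasure Q], BoundedContinuousFunction ℝ ℂ →L[ℂ] ℂ :=
    fun Q _ => LinearMap.mkContinuous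
      { toFun := fun f => ∫ x, f x ∂Q
        map_add' := fun f g => integral_add (f.integrable Q) (g.integrable Q)
        map_smul' := fun r f => integral_const_mul r _ } (Q.real Set.univ)
      fun f => f.norm_integral_le_mul_norm Q
  have : resolventSpan ≤ (I P).eqLocus (I P') := by
    refine Submodule.topologicalClosure_minimal _ (Submodule.span_le.2 ?_)
      (isClosed_eq (I P).continuous (I P').continuous)
    rintro a (rfl | ⟨z, rfl⟩)
    · exact h1
    · exact h z z.2
  exact this hf

/-- The star algebra generated by the resolvent functions lies in their closed span with `1`, where
the two integrals agree. It separates points, already through `(x - i)⁻¹`, and such an algebra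
determines a finite measure. -/
theorem ext_of_cauchyTransform {P P' : Measure ℝ} [IsFiniteMeasure P]
    [IsFiniteMeasure P'] (h1 : ∫ _, (1 : ℂ) ∂P = ∫ _, (1 : ℂ) ∂P')
    (h : ∀ z : ℂ, z.im ≠ 0 → ∫ x : ℝ, ((x : ℂ) - z)⁻¹ ∂P = ∫ x : ℝ, ((x : ℂ) - z)⁻¹ ∂P') :
    P = P' := by
  refine ext_of_forall_mem_subalgebra_integral_eq_of_pseudoEMetric_complete_countable
    (𝕜 := ℂ) (A := StarAlgebra.adjoin ℂ (Set.range resolventFun)) ?_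
    fun g hg => integral_eq_of_mem_resolventSpan h1 h (adjoin_resolventFun_le hg)
  intro x y hxy
  have hI : Complex.I.im ≠ 0 := by simp
  refine ⟨resolventFun ⟨Complex.I, hI⟩, ⟨_, ⟨resolventFun ⟨Complex.I, hI⟩,
    StarAlgebra.subset_adjoin _ _ ⟨_, rfl⟩, rfl⟩, rfl⟩, fun e => hxy ?_⟩
  rw [resolventFun_apply, resolventFun_apply, inv_inj, sub_left_inj] at e
  exact_mod_cast e

/-! ### Bessel's inequality -/

theorem IsSolution.integrable {s : ℕ → ℝ} {μ : Measure ℝ} (hμ : IsSolution s μ) (n : ℕ) :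
    Integrable (fun x : ℝ => x ^ n) μ := (hμ n).1

theorem IsSolution.isFiniteMeasure {s : ℕ → ℝ} {μ : Measure ℝ} (hμ : IsSolution s μ) :
    IsFiniteMeasure μ := by
  have := hμ.integrable 0
  simp only [pow_zero] at this
  exact (integrable_const_iff_isFiniteMeasure one_ne_zero).1 this

theorem IsSolution.integral_eval_eq {s : ℕ → ℝ} {μ ν : Measure ℝ} (hμ : IsSolution s μ)
    (hν : IsSolution s ν) (P : ℂ[X]) :
    ∫ x : ℝ, P.eval (x : ℂ) ∂μ = ∫ x : ℝ, P.eval (x : ℂ) ∂ν := by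
  have key : ∀ {ρ : Measure ℝ}, IsSolution s ρ →
      ∫ x : ℝ, P.eval (x : ℂ) ∂ρ = P.sum fun n a => a * (s n : ℂ) := by
    intro ρ hρ
    simp only [eval_eq_sum, Polynomial.sum]
    have hi : ∀ n, Integrable (fun x : ℝ => (x : ℂ) ^ n) ρ := fun n => by
      simpa using (hρ.integrable n).ofReal (𝕜 := ℂ)
    rw [integral_finsetSum _ fun i _ => (hi i).const_mul _]
    refine Finset.sum_congr rfl fun n _ => ?_
    rw [integral_const_mul, ← (hρ n).2, ← integral_complex_ofReal]
    simp
  rw [key hμ, key hν]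

theorem IsSolution.integral_orthoPoly_mul_orthoPoly {s : ℕ → ℝ} {μ ν : Measure ℝ}
    (hμ : IsSolution s μ) (hν : IsSolution s ν) (hsupp : μ.support.Infinite) (m n : ℕ) :
    ∫ x : ℝ, (((orthoPoly μ m).eval x : ℝ) : ℂ) * (((orthoPoly μ n).eval x : ℝ) : ℂ) ∂ν =
      if m = n then 1 else 0 := by
  have h1 := integral_eval_map hμ.integrable (orthoPoly μ m * orthoPoly μ n)
  rw [hμ.integral_eval_eq hν, orthoPoly_orthonormal hμ.integrable hsupp] at h1
  have h2 : (((if m = n then 1 else 0 : ℝ) : ℝ) : ℂ) = if m = n then 1 else 0 := by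
    split_ifs <;> simp
  rw [← h2, ← h1]
  refine integral_congr_ae (Filter.Eventually.of_forall fun x => ?_)
  have e : ∀ f : ℝ[X], (f.map (algebraMap ℝ ℂ)).eval (x : ℂ) = ((f.eval x : ℝ) : ℂ) := fun f =>
    eval_map_algebraMap f (x : ℂ) |>.trans (aeval_algebraMap_apply_eq_algebraMap_eval x f)
  simp only [e, eval_mul, Complex.ofReal_mul]

theorem IsSolution.memLp_eval {s : ℕ → ℝ} {ν : Measure ℝ} (hν : IsSolution s ν) (f : ℝ[X]) :
    MemLp (fun x : ℝ => ((f.eval x : ℝ) : ℂ)) 2 ν := by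
  have hc : Continuous fun x : ℝ => ((f.eval x : ℝ) : ℂ) :=
    Complex.continuous_ofReal.comp f.continuous
  rw [memLp_two_iff_integrable_sq_norm hc.aestronglyMeasurable]
  have := integrable_eval hν.integrable (f ^ 2)
  simpa using this

/-- Bessel's inequality for the orthonormal polynomials and another solution. -/
theorem IsSolution.summable_coeff {s : ℕ → ℝ} {μ ν : Measure ℝ} (hμ : IsSolution s μ)
    (hν : IsSolution s ν) (hsupp : μ.support.Infinite) {f : ℝ → ℂ} (hf : MemLp f 2 ν) :
    Summable fun n => ‖∫ x : ℝ, (((orthoPoly μ n).eval x : ℝ) : ℂ) * f x ∂ν‖ ^ 2 := by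
  let e : ℕ → Lp ℂ 2 ν := fun n => (hν.memLp_eval (orthoPoly μ n)).toLp
  have hin : ∀ (n : ℕ) {g : ℝ → ℂ} (hg : MemLp g 2 ν), inner ℂ (e n) hg.toLp =
      ∫ x : ℝ, (((orthoPoly μ n).eval x : ℝ) : ℂ) * g x ∂ν := by
    intro n g hg
    rw [L2.inner_def]
    refine integral_congr_ae ?_
    filter_upwards [(hν.memLp_eval (orthoPoly μ n)).coeFn_toLp, hg.coeFn_toLp] with x h1 h2
    rw [RCLike.inner_apply, h1, h2, Complex.conj_ofReal, mul_comm]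
  have he : Orthonormal ℂ e := by
    rw [orthonormal_iff_ite]
    intro m n
    rw [hin m (hν.memLp_eval (orthoPoly μ n)), hμ.integral_orthoPoly_mul_orthoPoly hν hsupp]
  have := he.inner_products_summable (x := hf.toLp)
  simpa only [hin _ hf] using this

theorem memℓp_two_iff {c : ℕ → ℂ} : Memℓp c 2 ↔ Summable fun n => ‖c n‖ ^ 2 := by
  rw [memℓp_gen_iff (by simp)]
  simp

/-- For non-real `z` the Cauchy transform `m` of a solution makes `q_z + m p_z` square
summable. -/
theorem IsSolution.memℓp_weyl {s : ℕ → ℝ} {μ ν : Measure ℝ} (hμ : IsSolution s μ)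
    (hν : IsSolution s ν) (hsupp : μ.support.Infinite) {z : ℂ} (hz : z.im ≠ 0) :
    Memℓp (qSeq μ z + (∫ x : ℝ, ((x : ℂ) - z)⁻¹ ∂ν) • pSeq μ z) 2 := by
  have := hν.isFiniteMeasure
  have hf : MemLp (resolventFun ⟨z, hz⟩) 2 ν := (resolventFun ⟨z, hz⟩).memLp_top.mono_exponent le_top
  rw [memℓp_two_iff]
  refine (hμ.summable_coeff hν hsupp hf).congr fun n => ?_
  congr 2
  set P := (orthoPoly μ n).map (algebraMap ℝ ℂ) with hP
  -- Splitting off `p_n(z) / (x - z)` leaves the difference quotient, a polynomial in `x`, whose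
  -- integral against `ν` is therefore also `q_n(z)`.
  have hx : ∀ x : ℝ, (((orthoPoly μ n).eval x : ℝ) : ℂ) * resolventFun ⟨z, hz⟩ x =
      (P /ₘ (X - C z)).eval (x : ℂ) + pSeq μ z n * ((x : ℂ) - z)⁻¹ := by
    intro x
    have h1 : P.eval (x : ℂ) = (((orthoPoly μ n).eval x : ℝ) : ℂ) :=
      eval_map_algebraMap _ (x : ℂ) |>.trans (aeval_algebraMap_apply_eq_algebraMap_eval x _)
    have h2 : P.eval z = pSeq μ z n := eval_map_algebraMap _ _
    have h3 := congrArg (eval (x : ℂ)) (divByMonic_spec P z)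
    simp only [eval_mul, eval_sub, eval_X, eval_C, h1, h2] at h3
    have hne := ofReal_sub_ne_zero hz x
    rw [resolventFun_apply, ← div_eq_mul_inv, ← div_eq_mul_inv, div_eq_iff hne, add_mul,
      div_mul_cancel₀ _ hne, mul_comm, h3]
    ring
  have hi : Integrable (fun x : ℝ => ((x : ℂ) - z)⁻¹) ν := (resolventFun ⟨z, hz⟩).integrable ν
  simp only [hx]
  rw [integral_add (integrable_eval_complex hν.integrable _) (hi.const_mul _), integral_const_mul,
    ← hμ.integral_eval_eq hν, ← qSeq_eq, Pi.add_apply, Pi.smul_apply, smul_eq_mul, mul_comm]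

/-- Hamburger's theorem: in the indeterminate case there is a point where both `p_z` and `q_z`
are square summable. -/
theorem IsIndeterminate.exists_memℓp {s : ℕ → ℝ} (hs : IsIndeterminate s) {μ : Measure ℝ}
    (hμ : IsSolution s μ) (hsupp : μ.support.Infinite) :
    ∃ z : ℂ, Memℓp (pSeq μ z) 2 ∧ Memℓp (qSeq μ z) 2 := by
  obtain ⟨ν, ρ, hν, hρ, hne⟩ := hs
  have := hν.isFiniteMeasure
  have := hρ.isFiniteMeasure
  obtain ⟨z, hz, hzne⟩ : ∃ z : ℂ, z.im ≠ 0 ∧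
      ∫ x : ℝ, ((x : ℂ) - z)⁻¹ ∂ν ≠ ∫ x : ℝ, ((x : ℂ) - z)⁻¹ ∂ρ := by
    by_contra! hcon
    refine hne (ext_of_cauchyTransform ?_ hcon)
    simpa using hν.integral_eval_eq hρ 1
  have h1 := hμ.memℓp_weyl hν hsupp hz
  have h2 := hμ.memℓp_weyl hρ hsupp hz
  have hp : Memℓp (pSeq μ z) 2 := by
    have h3 := (h1.sub h2).const_smul (∫ x : ℝ, ((x : ℂ) - z)⁻¹ ∂ν - ∫ x : ℝ, ((x : ℂ) - z)⁻¹ ∂ρ)⁻¹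
    rwa [add_sub_add_left_eq_sub, ← sub_smul, smul_smul,
      inv_mul_cancel₀ (sub_ne_zero.2 hzne), one_smul] at h3
  refine ⟨z, hp, ?_⟩
  have h4 := h1.sub (hp.const_smul (∫ x : ℝ, ((x : ℂ) - z)⁻¹ ∂ν))
  rwa [add_sub_cancel_right] at h4

/-! ### Discrete Wronskians -/

/-- The discrete Wronskian `a_n (x_n y_{n+1} - x_{n+1} y_n)`. -/
def wronskian (a : ℕ → ℝ) (x y : ℕ → ℂ) (n : ℕ) : ℂ :=
  a n * (x n * y (n + 1) - x (n + 1) * y n)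

theorem wronskian_succ (a b : ℕ → ℝ) (x y : ℕ → ℂ) (n : ℕ) :
    wronskian a x y (n + 1) = wronskian a x y n +
      (x (n + 1) * jacobiMul a b y (n + 1) - jacobiMul a b x (n + 1) * y (n + 1)) := by
  simp only [wronskian, jacobiMul]; ring

/-- Green's formula, in bilinear form without conjugation; the sum telescopes. -/
theorem sum_jacobiMul_eq_wronskian (a b : ℕ → ℝ) (x y : ℕ → ℂ) (n : ℕ) :
    ∑ i ∈ Finset.range (n + 1), (x i * jacobiMul a b y i - jacobiMul a b x i * y i) =
      wronskian a x y n := by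
  induction n with
  | zero => simp [jacobiMul, wronskian]; ring
  | succ n ih => rw [Finset.sum_range_succ, ih, wronskian_succ a b]

theorem wronskian_plucker (a : ℕ → ℝ) (x y p q : ℕ → ℂ) (n : ℕ) :
    wronskian a x y n * wronskian a p q n =
      wronskian a x p n * wronskian a y q n - wronskian a x q n * wronskian a y p n := by
  simp only [wronskian]; ring

/-- Variation of constants: where the Wronskian of `p`, `q` is `1`, the Wronskians of `x` with `q`
and `p` are, up to sign, its coefficients in the basis `p`, `q`. -/
theorem mul_wronskian (a : ℕ → ℝ) (x p q : ℕ → ℂ) (n : ℕ) :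
    x (n + 1) * wronskian a p q n =
      p (n + 1) * wronskian a x q n - q (n + 1) * wronskian a x p n := by
  simp only [wronskian]; ring

/-- If at one point `z₀` both solutions of the recurrence are square summable, then so are all
solutions at every point. -/
theorem memℓp_of_jacobiMul_eq {a b : ℕ → ℝ} {p q x : ℕ → ℂ} {z₀ z : ℂ} (hp : Memℓp p 2)
    (hq : Memℓp q 2) (hJp : ∀ n, jacobiMul a b p (n + 1) = z₀ * p (n + 1))
    (hJq : ∀ n, jacobiMul a b q (n + 1) = z₀ * q (n + 1)) (hw : wronskian a p q 0 = 1)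
    (hJx : ∀ n, jacobiMul a b x (n + 1) = z * x (n + 1)) : Memℓp x 2 := by
  have hw' : ∀ n, wronskian a p q n = 1 := by
    intro n
    induction n with
    | zero => exact hw
    | succ n ih => rw [wronskian_succ a b, ih, hJp, hJq]; ring
  set g : ℕ → ℝ := fun n => ‖p n‖ + ‖q n‖ with hg
  have hg0 : ∀ n, 0 ≤ g n := fun n => by positivity
  have hgs : Summable fun n => g n ^ 2 := by
    refine Summable.of_nonneg_of_le (fun n => sq_nonneg _) (fun n => ?_)
      (((memℓp_two_iff.1 hp).add (memℓp_two_iff.1 hq)).mul_left 2)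
    simp only [hg]
    nlinarith [sq_nonneg (‖p n‖ - ‖q n‖)]
  set S : ℕ → ℝ := fun n => ‖wronskian a x q n‖ + ‖wronskian a x p n‖ with hS
  have hS0 : ∀ n, 0 ≤ S n := fun n => by positivity
  have hx : ∀ n, ‖x (n + 1)‖ ≤ g (n + 1) * S n := by
    intro n
    have h1 := mul_wronskian a x p q n
    rw [hw', mul_one] at h1
    rw [h1]
    refine (norm_sub_le _ _).trans ?_
    rw [norm_mul, norm_mul]
    simp only [hg, hS]
    nlinarith [mul_nonneg (norm_nonneg (p (n + 1))) (norm_nonneg (wronskian a x p n)),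
      mul_nonneg (norm_nonneg (q (n + 1))) (norm_nonneg (wronskian a x q n))]
  -- Passing from `n` to `n + 1` changes the Wronskian of `x` with a solution `r` at `z₀` by `(z₀ -
  -- z) x_{n+1} r_{n+1}`. With `hx` this is a discrete Gronwall inequality whose weights `g²` are
  -- summable.
  have hstep : ∀ n, S (n + 1) ≤ S n * Real.exp (‖z₀ - z‖ * g (n + 1) ^ 2) := by
    intro n
    have hr : ∀ r : ℕ → ℂ, (∀ n, jacobiMul a b r (n + 1) = z₀ * r (n + 1)) →
        ‖wronskian a x r (n + 1)‖ ≤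
          ‖wronskian a x r n‖ + ‖z₀ - z‖ * ‖x (n + 1)‖ * ‖r (n + 1)‖ := by
      intro r h
      rw [wronskian_succ a b, h, hJx, ← norm_mul, ← norm_mul]
      refine (norm_add_le _ _).trans (le_of_eq ?_)
      congr 2
      ring
    calc S (n + 1) ≤ S n + ‖z₀ - z‖ * ‖x (n + 1)‖ * g (n + 1) := by
          simp only [hS, hg]
          linarith [hr p hJp, hr q hJq]
      _ ≤ S n + ‖z₀ - z‖ * (g (n + 1) * S n) * g (n + 1) := by
          gcongr
          exact hx n
      _ = S n * (‖z₀ - z‖ * g (n + 1) ^ 2 + 1) := by ring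
      _ ≤ _ := mul_le_mul_of_nonneg_left (Real.add_one_le_exp _) (hS0 n)
  have hbound : ∀ n, S n ≤ S 0 * Real.exp (‖z₀ - z‖ * ∑ i ∈ Finset.range (n + 1), g i ^ 2) := by
    intro n
    induction n with
    | zero => exact le_mul_of_one_le_right (hS0 0) (Real.one_le_exp (by simp; positivity))
    | succ n ih =>
      refine (hstep n).trans ?_
      rw [Finset.sum_range_succ, mul_add, Real.exp_add, ← mul_assoc]
      exact mul_le_mul_of_nonneg_right ih (Real.exp_nonneg _)
  set M := S 0 * Real.exp (‖z₀ - z‖ * ∑' i, g i ^ 2) with hM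
  have hSM : ∀ n, S n ≤ M := by
    intro n
    refine (hbound n).trans (mul_le_mul_of_nonneg_left (Real.exp_le_exp.2 ?_) (hS0 0))
    exact mul_le_mul_of_nonneg_left (hgs.sum_le_tsum _ fun i _ => sq_nonneg _) (norm_nonneg _)
  rw [memℓp_two_iff, ← summable_nat_add_iff 1]
  refine Summable.of_nonneg_of_le (fun n => sq_nonneg _) (fun n => ?_)
    (((summable_nat_add_iff 1).2 hgs).mul_right (M ^ 2))
  rw [← mul_pow]
  exact pow_le_pow_left₀ (norm_nonneg _)
    ((hx n).trans (mul_le_mul_of_nonneg_left (hSM n) (hg0 _))) 2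

theorem IsIndeterminate.memℓp {s : ℕ → ℝ} (hs : IsIndeterminate s) {μ : Measure ℝ}
    (hμ : IsSolution s μ) (hsupp : μ.support.Infinite) (h0 : ∫ _, (1 : ℝ) ∂μ = 1) (z : ℂ) :
    Memℓp (pSeq μ z) 2 ∧ Memℓp (qSeq μ z) 2 := by
  obtain ⟨z₀, hp, hq⟩ := hs.exists_memℓp hμ hsupp
  have hJp := fun w => jacobiMul_pSeq hμ.integrable hsupp w
  have hJq := fun w => jacobiMul_qSeq hμ.integrable hsupp h0 w
  -- Only row `0` of the equation for `q_w` is inhomogeneous; in the later rows `p_w` and `q_w`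
  -- solve the same recurrence.
  have hq' : ∀ w n, jacobiMul (jacobiA μ) (jacobiB μ) (qSeq μ w) (n + 1) = w * qSeq μ w (n + 1) :=
    fun w n => by rw [hJq]; simp
  have hw : wronskian (jacobiA μ) (pSeq μ z₀) (qSeq μ z₀) 0 = 1 := by
    rw [← sum_jacobiMul_eq_wronskian (jacobiA μ) (jacobiB μ), zero_add, Finset.sum_range_one, hJp,
      hJq, qSeq_zero h0, pSeq_zero h0]
    simp
  exact ⟨memℓp_of_jacobiMul_eq hp hq (fun n => hJp _ _) (hq' z₀) hw fun n => hJp z _,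
    memℓp_of_jacobiMul_eq hp hq (fun n => hJp _ _) (hq' z₀) hw (hq' z)⟩

/-! ### The boundary form -/

theorem summable_mul_of_memℓp {x y : ℕ → ℂ} (hx : Memℓp x 2) (hy : Memℓp y 2) :
    Summable fun k => x k * y k := by
  refine Summable.of_norm_bounded ((memℓp_two_iff.1 hx).add (memℓp_two_iff.1 hy)) fun k => ?_
  rw [norm_mul]
  nlinarith [sq_nonneg (‖x k‖ - ‖y k‖), sq_nonneg (‖x k‖ + ‖y k‖)]

theorem memℓp_conj {x : ℕ → ℂ} (hx : Memℓp x 2) : Memℓp (fun k => (starRingEnd ℂ) (x k)) 2 := by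
  rw [memℓp_two_iff] at hx ⊢
  simpa using hx

theorem jacobiMul_conj (a b : ℕ → ℝ) (x : ℕ → ℂ) (n : ℕ) :
    jacobiMul a b (fun k => (starRingEnd ℂ) (x k)) n = (starRingEnd ℂ) (jacobiMul a b x n) := by
  cases n <;> simp [jacobiMul]

/-- The boundary form `∑ (x_k (J y)_k - (J x)_k y_k)` of the Jacobi matrix. -/
noncomputable def boundaryForm (a b : ℕ → ℝ) (x y : ℕ → ℂ) : ℂ :=
  ∑' k, (x k * jacobiMul a b y k - jacobiMul a b x k * y k)

/-- The maximal domain of the Jacobi matrix. -/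
def IsMaximalDomain (a b : ℕ → ℝ) (x : ℕ → ℂ) : Prop :=
  Memℓp x 2 ∧ Memℓp (jacobiMul a b x) 2

theorem IsMaximalDomain.add_smul {a b : ℕ → ℝ} {x y : ℕ → ℂ} (hx : IsMaximalDomain a b x)
    (hy : IsMaximalDomain a b y) (r : ℂ) : IsMaximalDomain a b (x + r • y) := by
  refine ⟨hx.1.add (hy.1.const_smul r), ?_⟩
  rw [jacobiMul_add, jacobiMul_smul]
  exact hx.2.add (hy.2.const_smul r)

theorem IsMaximalDomain.conj {a b : ℕ → ℝ} {x : ℕ → ℂ} (hx : IsMaximalDomain a b x) :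
    IsMaximalDomain a b (fun k => (starRingEnd ℂ) (x k)) := by
  refine ⟨memℓp_conj hx.1, ?_⟩
  rw [funext (jacobiMul_conj a b x)]
  exact memℓp_conj hx.2

theorem boundaryForm_summable {a b : ℕ → ℝ} {x y : ℕ → ℂ} (hx : IsMaximalDomain a b x)
    (hy : IsMaximalDomain a b y) :
    Summable fun k => x k * jacobiMul a b y k - jacobiMul a b x k * y k :=
  (summable_mul_of_memℓp hx.1 hy.2).sub (summable_mul_of_memℓp hx.2 hy.1)

theorem boundaryForm_add_smul {a b : ℕ → ℝ} {x y w : ℕ → ℂ} (hx : IsMaximalDomain a b x)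
    (hy : IsMaximalDomain a b y) (hw : IsMaximalDomain a b w) (r : ℂ) :
    boundaryForm a b (x + r • y) w = boundaryForm a b x w + r * boundaryForm a b y w := by
  rw [boundaryForm, boundaryForm, boundaryForm, ← tsum_mul_left,
    ← (boundaryForm_summable hx hw).tsum_add ((boundaryForm_summable hy hw).mul_left r)]
  refine tsum_congr fun k => ?_
  rw [jacobiMul_add, jacobiMul_smul]
  simp only [Pi.add_apply, Pi.smul_apply, smul_eq_mul]
  ring

theorem tendsto_wronskian {a b : ℕ → ℝ} {x y : ℕ → ℂ} (hx : IsMaximalDomain a b x)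
    (hy : IsMaximalDomain a b y) :
    Filter.Tendsto (wronskian a x y) Filter.atTop (nhds (boundaryForm a b x y)) := by
  have := (Filter.tendsto_add_atTop_iff_nat 1).2
    (boundaryForm_summable hx hy).hasSum.tendsto_sum_nat
  simp only [sum_jacobiMul_eq_wronskian] at this
  exact this

theorem boundaryForm_plucker {a b : ℕ → ℝ} {x y p q : ℕ → ℂ} (hx : IsMaximalDomain a b x)
    (hy : IsMaximalDomain a b y) (hp : IsMaximalDomain a b p) (hq : IsMaximalDomain a b q) :
    boundaryForm a b x y * boundaryForm a b p q =
      boundaryForm a b x p * boundaryForm a b y q - boundaryForm a b x q * boundaryForm a b y p :=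
  tendsto_nhds_unique ((tendsto_wronskian hx hy).mul (tendsto_wronskian hp hq))
    ((((tendsto_wronskian hx hp).mul (tendsto_wronskian hy hq)).sub
      ((tendsto_wronskian hx hq).mul (tendsto_wronskian hy hp))).congr fun n =>
        (wronskian_plucker a x y p q n).symm)

/-! ### The domain of the closure -/

theorem continuous_coord (n : ℕ) : Continuous fun c : Ell2 => c n :=
  (lp.evalCLM ℂ (fun _ : ℕ => ℂ) 2 n).continuous

theorem continuous_jacobiMul (a b : ℕ → ℝ) (n : ℕ) :
    Continuous fun c : Ell2 => jacobiMul a b c n := by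
  have h : ∀ (r : ℝ) (k : ℕ), Continuous fun c : Ell2 => (r : ℂ) * c k := fun r k =>
    continuous_const.mul (continuous_coord k)
  cases n with
  | zero => exact (h _ _).add (h _ _)
  | succ n => exact ((h _ _).add (h _ _)).add (h _ _)

theorem inner_eq_tsum (c d : Ell2) : inner ℂ d c = ∑' k, c k * (starRingEnd ℂ) (d k) :=
  (lp.inner_eq_tsum d c).trans (tsum_congr fun _ => RCLike.inner_apply _ _)

/-- Each coordinate of `Jc` is continuous in `c`, so the limit of the images is `Jc`. Green's
formula for finite sequences has no boundary term and passes to the limit. Conjugating `y`, harmless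
as `J` is real, turns inner products into the bilinear form. -/
theorem jacobiOp_domain_boundary {μ : Measure ℝ} {c : Ell2} (hc : c ∈ (jacobiOp μ).domain) :
    IsMaximalDomain (jacobiA μ) (jacobiB μ) c ∧
      ∀ y, IsMaximalDomain (jacobiA μ) (jacobiB μ) y →
        boundaryForm (jacobiA μ) (jacobiB μ) c y = 0 := by
  obtain ⟨x, d, hx, hd⟩ := (mem_jacobiOp_domain_iff μ c).1 hc
  have hdc : (d : ℕ → ℂ) = jacobiMul (jacobiA μ) (jacobiB μ) c := by
    ext n
    exact tendsto_nhds_unique (((continuous_coord n).tendsto _).comp hd)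
      (((continuous_jacobiMul _ _ n).tendsto _).comp hx)
  have hm : IsMaximalDomain (jacobiA μ) (jacobiB μ) c := ⟨lp.memℓp c, hdc ▸ lp.memℓp d⟩
  refine ⟨hm, fun y hy => ?_⟩
  have hy' := hy.conj
  let Y : Ell2 := ⟨_, hy'.1⟩
  let JY : Ell2 := ⟨_, hy'.2⟩
  have h1 : inner ℂ JY c = inner ℂ Y d := by
    refine tendsto_nhds_unique ((tendsto_const_nhds.inner hx).congr fun k => ?_)
      (tendsto_const_nhds.inner hd)
    exact inner_jacobiMul _ _ (x k : Ell2) Y _ JY (x k).2 rfl rfl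
  rw [inner_eq_tsum, inner_eq_tsum, hdc] at h1
  rw [boundaryForm, (summable_mul_of_memℓp hm.1 hy.2).tsum_sub (summable_mul_of_memℓp hm.2 hy.1),
    sub_eq_zero]
  have e1 : ∀ k, JY k = (starRingEnd ℂ) (jacobiMul (jacobiA μ) (jacobiB μ) y k) :=
    jacobiMul_conj _ _ y
  have e2 : ∀ k, Y k = (starRingEnd ℂ) (y k) := fun _ => rfl
  simpa only [e1, e2, Complex.conj_conj] using h1

theorem single_mem_finSeq (n : ℕ) : lp.single 2 n (1 : ℂ) ∈ finSeq := by
  refine (Set.finite_singleton n).subset fun j hj => ?_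
  by_contra h
  exact hj (by simp [Pi.single_eq_of_ne (show j ≠ n from h)])

/-- Green's formula up to index `n + 1`, where the Wronskian vanishes because `e_n` is zero at `n +
1` and `n + 2`. -/
theorem tsum_jacobiMul_single_mul (a b : ℕ → ℝ) (y : ℕ → ℂ) (n : ℕ) :
    ∑' k, jacobiMul a b (Pi.single n 1) k * y k = jacobiMul a b y n := by
  have hz : ∀ k, n + 1 < k → jacobiMul a b (Pi.single n 1) k = 0 := by
    intro k hk
    obtain ⟨m, rfl⟩ : ∃ m, k = m + 1 := ⟨k - 1, by omega⟩
    simp [jacobiMul, Pi.single_eq_of_ne (show m ≠ n by omega),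
      Pi.single_eq_of_ne (show m + 1 ≠ n by omega), Pi.single_eq_of_ne (show m + 2 ≠ n by omega)]
  rw [tsum_eq_sum (s := Finset.range (n + 1 + 1)) fun k hk => by
    rw [hz k (by simpa using hk), zero_mul]]
  have h1 := sum_jacobiMul_eq_wronskian a b (Pi.single n 1) y (n + 1)
  rw [Finset.sum_sub_distrib, wronskian, Pi.single_eq_of_ne (show n + 1 ≠ n by omega),
    Pi.single_eq_of_ne (show n + 1 + 1 ≠ n by omega),
    Finset.sum_eq_single_of_mem n (by simp) (fun k _ hk => by
      rw [Pi.single_eq_of_ne hk, zero_mul])] at h1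
  rw [Pi.single_eq_same] at h1
  linear_combination -h1

/-- If `(c, Jc)` were outside the closed graph, a continuous functional, given by a pair `(u, v)`,
would vanish on the graph but not at `(c, Jc)`. Testing on `e_n` gives `J v̄ = -ū`, so `v̄` is in
the maximal domain, and `W(c, v̄) = 0` says that the functional does vanish at `(c, Jc)`. -/
theorem mem_jacobiOp_domain_of_boundary {μ : Measure ℝ} {c : Ell2}
    (hc : IsMaximalDomain (jacobiA μ) (jacobiB μ) c)
    (hb : ∀ y, IsMaximalDomain (jacobiA μ) (jacobiB μ) y →
      boundaryForm (jacobiA μ) (jacobiB μ) c y = 0) : c ∈ (jacobiOp μ).domain := by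
  set M := jacobiMatrixOp (jacobiA μ) (jacobiB μ) with hM
  have hg := (jacobiMatrixOp_isClosable (jacobiA μ) (jacobiB μ)).graph_closure_eq_closure_graph
  let d : Ell2 := ⟨_, hc.2⟩
  rw [LinearPMap.mem_domain_iff]
  refine ⟨d, ?_⟩
  rw [jacobiOp, ← hg]
  by_contra hcd
  obtain ⟨f, hfG, hf⟩ : ∃ f : (Ell2 × Ell2) →L[ℂ] ℂ, (∀ w ∈ M.graph, f w = 0) ∧ f (c, d) ≠ 0 := by
    let G := M.graph.topologicalClosure
    have : IsClosed (G : Set (Ell2 × Ell2)) := Submodule.isClosed_topologicalClosure _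
    obtain ⟨f, hf⟩ := SeparatingDual.exists_ne_zero (R := ℂ) (x := G.mkQ (c, d))
      fun h => hcd ((Submodule.Quotient.mk_eq_zero G).1 h)
    refine ⟨f.comp G.mkQL, fun w hw => ?_, hf⟩
    have : G.mkQ w = 0 := (Submodule.Quotient.mk_eq_zero G).2
      (Submodule.le_topologicalClosure _ hw)
    show f (G.mkQ w) = 0
    rw [this, map_zero]
  let u : Ell2 := (InnerProductSpace.toDual ℂ Ell2).symm (f.comp (.inl ℂ Ell2 Ell2))
  let v : Ell2 := (InnerProductSpace.toDual ℂ Ell2).symm (f.comp (.inr ℂ Ell2 Ell2))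
  have hfuv : ∀ x y : Ell2, f (x, y) = inner ℂ u x + inner ℂ v y := by
    intro x y
    rw [InnerProductSpace.toDual_symm_apply, InnerProductSpace.toDual_symm_apply]
    simp [← map_add]
  have hJv : jacobiMul (jacobiA μ) (jacobiB μ) (fun k => (starRingEnd ℂ) (v k)) =
      -fun k => (starRingEnd ℂ) (u k) := by
    ext n
    have h1 := hfG _ (M.mem_graph ⟨lp.single 2 n (1 : ℂ), single_mem_finSeq n⟩)
    rw [hfuv, inner_eq_tsum, inner_eq_tsum] at h1
    have h2 : ∀ k, (M ⟨lp.single 2 n (1 : ℂ), single_mem_finSeq n⟩ : Ell2) k =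
        jacobiMul (jacobiA μ) (jacobiB μ) (Pi.single n 1) k := fun k => by
      show jacobiMul (jacobiA μ) (jacobiB μ) (lp.single 2 n (1 : ℂ) : Ell2) k = _
      rw [lp.coeFn_single]
    simp only [h2] at h1
    rw [tsum_jacobiMul_single_mul _ _ (fun k => (starRingEnd ℂ) (v k)), tsum_eq_single n] at h1
    · simp at h1
      rw [Pi.neg_apply]
      linear_combination h1
    · intro k hk
      simp [Pi.single_eq_of_ne hk]
  have hv : IsMaximalDomain (jacobiA μ) (jacobiB μ) (fun k => (starRingEnd ℂ) (v k)) :=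
    ⟨memℓp_conj (lp.memℓp v), hJv ▸ (memℓp_conj (lp.memℓp u)).neg⟩
  apply hf
  have h3 := hb _ hv
  rw [boundaryForm, (summable_mul_of_memℓp hc.1 hv.2).tsum_sub (summable_mul_of_memℓp hc.2 hv.1),
    hJv] at h3
  simp only [Pi.neg_apply, mul_neg, tsum_neg] at h3
  rw [hfuv, inner_eq_tsum, inner_eq_tsum]
  change _ + ∑' k, jacobiMul (jacobiA μ) (jacobiB μ) c k * (starRingEnd ℂ) (v k) = 0
  linear_combination -h3

/-- If the maximal domain contains `p`, `q` with boundary form `1`, then the domain of the Jacobi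
operator is cut out by the boundary conditions at `p` and `q`. -/
theorem mem_jacobiOp_domain_iff_boundary {μ : Measure ℝ} {p q : ℕ → ℂ}
    (hp : IsMaximalDomain (jacobiA μ) (jacobiB μ) p)
    (hq : IsMaximalDomain (jacobiA μ) (jacobiB μ) q)
    (hpq : boundaryForm (jacobiA μ) (jacobiB μ) p q = 1) {c : Ell2}
    (hc : IsMaximalDomain (jacobiA μ) (jacobiB μ) c) :
    c ∈ (jacobiOp μ).domain ↔ boundaryForm (jacobiA μ) (jacobiB μ) c p = 0 ∧
      boundaryForm (jacobiA μ) (jacobiB μ) c q = 0 := by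
  refine ⟨fun h => ⟨(jacobiOp_domain_boundary h).2 p hp, (jacobiOp_domain_boundary h).2 q hq⟩,
    fun ⟨h1, h2⟩ => mem_jacobiOp_domain_of_boundary hc fun y hy => ?_⟩
  have := boundaryForm_plucker hc hy hp hq
  rwa [hpq, h1, h2, mul_one, zero_mul, zero_mul, sub_zero] at this

/-! ### The boundary form on solutions of the recurrence -/

/-- The numbers `r`, `t` are the inhomogeneities in row `0`: `0` for `p_z` and `1` for `q_z`. They
produce the constants `-1` and `1` in `B` and `C`. -/
theorem boundaryForm_eq {a b : ℕ → ℝ} {x y : ℕ → ℂ} (hx : Memℓp x 2) (hy : Memℓp y 2)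
    {u v r t : ℂ} (hJx : ∀ n, jacobiMul a b x n = u * x n + if n = 0 then r else 0)
    (hJy : ∀ n, jacobiMul a b y n = v * y n + if n = 0 then t else 0) :
    boundaryForm a b x y = -((u - v) * ∑' k, x k * y k) + (t * x 0 - r * y 0) := by
  have h1 := ((summable_mul_of_memℓp hx hy).mul_left (-(u - v))).hasSum.add
    (hasSum_ite_eq (0 : ℕ) (t * x 0 - r * y 0))
  rw [boundaryForm, ← neg_mul, ← tsum_mul_left, ← h1.tsum_eq]
  refine tsum_congr fun k => ?_
  rw [hJx, hJy]
  split_ifs with hk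
  · subst hk; ring
  · ring

theorem isMaximalDomain_of_eq {a b : ℕ → ℝ} {x : ℕ → ℂ} (hx : Memℓp x 2)
    {u r : ℂ} (hJx : ∀ n, jacobiMul a b x n = u * x n + if n = 0 then r else 0) :
    IsMaximalDomain a b x := by
  refine ⟨hx, ?_⟩
  have : jacobiMul a b x = u • x + (lp.single 2 0 r : Ell2) := by
    ext n
    rw [hJx]
    rcases eq_or_ne n 0 with rfl | h
    · simp
    · simp [h]
  rw [this]
  exact (hx.const_smul u).add (lp.memℓp _)

end JacobiMoment

/-! ### Boundary values of `p_z`, `q_z` and the membership criteria -/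

open JacobiMoment in
theorem mainTheorem1 (s : ℕ → ℝ) (hs0 : s 0 = 1) (hs : JacobiMoment.IsIndeterminate s)
    (μ : MeasureTheory.Measure ℝ) (hμ : JacobiMoment.IsSolution s μ)
    (hsupp : μ.support.Infinite) :
    ∃ (hp : ∀ z : ℂ, Memℓp (JacobiMoment.pSeq μ z) 2)
      (hq : ∀ z : ℂ, Memℓp (JacobiMoment.qSeq μ z) 2),
      let T := JacobiMoment.jacobiOp μ
      let p : ℂ → JacobiMoment.Ell2 := fun z => ⟨JacobiMoment.pSeq μ z, hp z⟩
      let q : ℂ → JacobiMoment.Ell2 := fun z => ⟨JacobiMoment.qSeq μ z, hq z⟩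
      (∀ z : ℂ, p z ∉ T.domain ∧ q z ∉ T.domain) ∧
      (∀ u v : ℂ,
        ((∃ α : ℂ, p u + α • p v ∈ T.domain) ↔ JacobiMoment.nevD μ u v = 0) ∧
        (∀ α : ℂ, p u + α • p v ∈ T.domain → α = JacobiMoment.nevB μ u v) ∧
        ((∃ β : ℂ, q u + β • q v ∈ T.domain) ↔ JacobiMoment.nevA μ u v = 0) ∧
        (∀ β : ℂ, q u + β • q v ∈ T.domain → β = -JacobiMoment.nevC μ u v) ∧
        ((∃ γ : ℂ, p u + γ • q v ∈ T.domain) ↔ JacobiMoment.nevB μ u v = 0) ∧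
        (∀ γ : ℂ, p u + γ • q v ∈ T.domain → γ = -JacobiMoment.nevD μ u v)) ∧
      (∀ u γ : ℂ, p u + γ • q u ∉ T.domain) := by
  have h0 : ∫ _, (1 : ℝ) ∂μ = 1 := by
    simpa only [pow_zero, hs0] using (hμ 0).2
  have hp := fun z => (hs.memℓp hμ hsupp h0 z).1
  have hq := fun z => (hs.memℓp hμ hsupp h0 z).2
  -- The vacuous `if` gives `p_z` the same form of equation as `q_z`, with inhomogeneity `0`.
  have hJp : ∀ z n, jacobiMul (jacobiA μ) (jacobiB μ) (pSeq μ z) n =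
      z * pSeq μ z n + if n = 0 then 0 else 0 := fun z n => by
    rw [jacobiMul_pSeq hμ.integrable hsupp, ite_self, add_zero]
  have hJq := fun z => jacobiMul_qSeq hμ.integrable hsupp h0 z
  have mp := fun z => isMaximalDomain_of_eq (hp z) (hJp z)
  have mq := fun z => isMaximalDomain_of_eq (hq z) (hJq z)
  have wpp : ∀ u v, boundaryForm (jacobiA μ) (jacobiB μ) (pSeq μ u) (pSeq μ v) = -nevD μ u v :=
    fun u v => by rw [boundaryForm_eq (hp u) (hp v) (hJp u) (hJp v), nevD]; ring
  have wpq : ∀ u v, boundaryForm (jacobiA μ) (jacobiB μ) (pSeq μ u) (qSeq μ v) = -nevB μ u v :=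
    fun u v => by
      rw [boundaryForm_eq (hp u) (hq v) (hJp u) (hJq v), nevB, pSeq_zero h0, qSeq_zero h0]; ring
  have wqp : ∀ u v, boundaryForm (jacobiA μ) (jacobiB μ) (qSeq μ u) (pSeq μ v) = -nevC μ u v :=
    fun u v => by
      rw [boundaryForm_eq (hq u) (hp v) (hJq u) (hJp v), nevC, pSeq_zero h0, qSeq_zero h0]; ring
  have wqq : ∀ u v, boundaryForm (jacobiA μ) (jacobiB μ) (qSeq μ u) (qSeq μ v) = -nevA μ u v :=
    fun u v => by
      rw [boundaryForm_eq (hq u) (hq v) (hJq u) (hJq v), nevA, qSeq_zero h0, qSeq_zero h0]; ring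
  have dA : ∀ v, nevA μ v v = 0 := fun v => by simp [nevA]
  have dB : ∀ v, nevB μ v v = -1 := fun v => by simp [nevB]
  have dC : ∀ v, nevC μ v v = 1 := fun v => by simp [nevC]
  have dD : ∀ v, nevD μ v v = 0 := fun v => by simp [nevD]
  -- Any `v` can serve as base point, since `W(p_v, q_v) = -B(v,v) = 1`.
  have crit : ∀ v {c : Ell2}, IsMaximalDomain (jacobiA μ) (jacobiB μ) c →
      (c ∈ (jacobiOp μ).domain ↔ boundaryForm (jacobiA μ) (jacobiB μ) c (pSeq μ v) = 0 ∧
        boundaryForm (jacobiA μ) (jacobiB μ) c (qSeq μ v) = 0) := fun v c hc =>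
    mem_jacobiOp_domain_iff_boundary (mp v) (mq v) (by rw [wpq, dB, neg_neg]) hc
  refine ⟨hp, hq, ?_⟩
  intro T p q
  have kp : ∀ z, p z ∈ T.domain ↔ False := fun z => by
    rw [crit z (c := p z) (mp z)]
    change boundaryForm _ _ (pSeq μ z) _ = 0 ∧ boundaryForm _ _ (pSeq μ z) _ = 0 ↔ False
    rw [wpp, wpq, dB]; simp
  have kq : ∀ z, q z ∈ T.domain ↔ False := fun z => by
    rw [crit z (c := q z) (mq z)]
    change boundaryForm _ _ (qSeq μ z) _ = 0 ∧ boundaryForm _ _ (qSeq μ z) _ = 0 ↔ False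
    rw [wqp, wqq, dC]; simp
  -- The base point is the parameter of the second summand: `D(v,v) = 0` removes `α` from the
  -- `p_v`-condition, and `B(v,v) = -1` solves the `q_v`-condition for `α`.
  have kpp : ∀ u v α, p u + α • p v ∈ T.domain ↔ nevD μ u v = 0 ∧ α = nevB μ u v :=
    fun u v α => by
      rw [crit v (c := p u + α • p v) ((mp u).add_smul (mp v) α)]
      change boundaryForm _ _ (pSeq μ u + α • pSeq μ v) _ = 0 ∧
        boundaryForm _ _ (pSeq μ u + α • pSeq μ v) _ = 0 ↔ _
      rw [boundaryForm_add_smul (mp u) (mp v) (mp v), boundaryForm_add_smul (mp u) (mp v) (mq v),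
        wpp, wpp, wpq, wpq, dB, dD]
      refine and_congr (by simp) ⟨fun h => by linear_combination h, fun h => by rw [h]; ring⟩
  have kqq : ∀ u v β, q u + β • q v ∈ T.domain ↔ nevA μ u v = 0 ∧ β = -nevC μ u v :=
    fun u v β => by
      -- Now `A(v,v) = 0` frees the `q_v`-condition of the coefficient, hence the swap.
      rw [crit v (c := q u + β • q v) ((mq u).add_smul (mq v) β), and_comm]
      change boundaryForm _ _ (qSeq μ u + β • qSeq μ v) _ = 0 ∧
        boundaryForm _ _ (qSeq μ u + β • qSeq μ v) _ = 0 ↔ _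
      rw [boundaryForm_add_smul (mq u) (mq v) (mp v), boundaryForm_add_smul (mq u) (mq v) (mq v),
        wqp, wqp, wqq, wqq, dC, dA]
      refine and_congr (by simp) ⟨fun h => by linear_combination -h, fun h => by rw [h]; ring⟩
  have kpq : ∀ u v γ, p u + γ • q v ∈ T.domain ↔ nevB μ u v = 0 ∧ γ = -nevD μ u v :=
    fun u v γ => by
      rw [crit v (c := p u + γ • q v) ((mp u).add_smul (mq v) γ), and_comm]
      change boundaryForm _ _ (pSeq μ u + γ • qSeq μ v) _ = 0 ∧
        boundaryForm _ _ (pSeq μ u + γ • qSeq μ v) _ = 0 ↔ _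
      rw [boundaryForm_add_smul (mp u) (mq v) (mp v), boundaryForm_add_smul (mp u) (mq v) (mq v),
        wpp, wqp, wpq, wqq, dC, dA]
      refine and_congr (by simp) ⟨fun h => by linear_combination -h, fun h => by rw [h]; ring⟩
  refine ⟨fun z => ⟨(kp z).1, (kq z).1⟩, fun u v => ⟨?_, ?_, ?_, ?_, ?_, ?_⟩, fun u γ h => ?_⟩
  · simp only [kpp, exists_and_left, exists_eq, and_true]
  · exact fun α h => ((kpp u v α).1 h).2
  · simp only [kqq, exists_and_left, exists_eq, and_true]
  · exact fun β h => ((kqq u v β).1 h).2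
  · simp only [kpq, exists_and_left, exists_eq, and_true]
  · exact fun γ h => ((kpq u v γ).1 h).2
  · have := ((kpq u u γ).1 h).1
    rw [dB] at this
    simp at this
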